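/- Let $A$ be a separable (not necessarily unital) complex C*-algebra. Let $\operatorname{Prim} A$ be the set of primitive ideals of $A$, i.e. kernels of non-zero irreducible $*$-representations of $A$ on Hilbert spaces, with the hull-kernel topology, whose open sets are the sets $\{P \in \operatorname{Prim} A : I \not\subseteq P\}$ for closed two-sided ideals $I$ of $A$. Let $\mathcal I(A)$ be the complete lattice of closed two-sided ideals of $A$, ordered by inclusion, and let $[0,1]$ be the unit interval with its usual order. In a complete lattice, $x$ is compactly contained in $y$, written $x \Subset y$, if whenever $(y_i)$ is an increasing net with $y \le \sup_i y_i$, one has $x \le y_i$ for some $i$. Suppose that $\operatorname{Prim} A$ has no non-empty, compact, open subsets (where compact means that every open cover has a finite subcover, without any separation axiom). Then there exists a Cu-morphism $\Phi \colon \mathcal I(A) \to [0,1]$, i.e. an order preserving map with $\Phi(\sup S) = \sup \Phi(S)$ for every subset $S \subseteq \mathcal I(A)$ and such that $I \Subset J$ implies $\Phi(I) \Subset \Phi(J)$, for which $\Phi^{-1}(\{0\}) = \{0\}$. -/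

import Mathlib

universe u v

/-! ### Compact containment and Cu-morphisms -/

/-- `x` is compactly contained in (way below) `y`: every increasing net whose supremum dominates
`y` has a member dominating `x`. Increasing nets are given by their ranges, the non-empty
directed subsets. -/
def CompactlyContained {L : Type u} [CompleteLattice L] (x y : L) : Prop :=
  ∀ D : Set L, D.Nonempty → DirectedOn (· ≤ ·) D → y ≤ sSup D → ∃ d ∈ D, x ≤ d

/-- A Cu-morphism between complete lattices: an order preserving map that preserves arbitrary
suprema and compact containment. -/
structure IsCuMorphism {L : Type u} {M : Type v} [CompleteLattice L] [CompleteLattice M]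
    (Φ : L → M) : Prop where
  monotone : Monotone Φ
  map_sSup : ∀ S : Set L, Φ (sSup S) = sSup (Φ '' S)
  map_compactlyContained :
    ∀ x y : L, CompactlyContained x y → CompactlyContained (Φ x) (Φ y)

/-! ### The ideal lattice of a C*-algebra -/

/-- The closed two-sided ideals of a (not necessarily unital) C*-algebra. -/
structure ClosedIdeal (A : Type u) [NonUnitalCStarAlgebra A] extends Submodule ℂ A where
  mul_mem_left' : ∀ (a : A) {x : A}, x ∈ carrier → a * x ∈ carrier
  mul_mem_right' : ∀ (a : A) {x : A}, x ∈ carrier → x * a ∈ carrier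
  isClosed' : IsClosed carrier

namespace ClosedIdeal

variable {A : Type u} [NonUnitalCStarAlgebra A]

instance : SetLike (ClosedIdeal A) A where
  coe I := I.carrier
  coe_injective I J h := by
    obtain ⟨I, _, _, _⟩ := I
    obtain ⟨J, _, _, _⟩ := J
    have : I = J := SetLike.coe_injective h
    subst this
    rfl

/-- Ideals are ordered by inclusion. -/
instance : PartialOrder (ClosedIdeal A) := .ofSetLike (ClosedIdeal A) A

theorem mul_mem_left (I : ClosedIdeal A) (a : A) {x : A} (hx : x ∈ I) : a * x ∈ I :=
  I.mul_mem_left' a hx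

theorem mul_mem_right (I : ClosedIdeal A) (a : A) {x : A} (hx : x ∈ I) : x * a ∈ I :=
  I.mul_mem_right' a hx

theorem isClosed (I : ClosedIdeal A) : IsClosed (I : Set A) := I.isClosed'

/-- The whole algebra. -/
instance : Top (ClosedIdeal A) where
  top :=
    { (⊤ : Submodule ℂ A) with
      mul_mem_left' := fun _ _ _ => trivial
      mul_mem_right' := fun _ _ _ => trivial
      isClosed' := isClosed_univ }

/-- The zero ideal. -/
instance : Bot (ClosedIdeal A) where
  bot :=
    { (⊥ : Submodule ℂ A) with
      mul_mem_left' := by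
        intro a x (hx : x = 0)
        change a * x = 0
        simp [hx]
      mul_mem_right' := by
        intro a x (hx : x = 0)
        change x * a = 0
        simp [hx]
      isClosed' := isClosed_singleton }

/-- The intersection of two ideals. -/
instance : Min (ClosedIdeal A) where
  min I J :=
    { I.toSubmodule ⊓ J.toSubmodule with
      mul_mem_left' := fun a _ hx => ⟨I.mul_mem_left' a hx.1, J.mul_mem_left' a hx.2⟩
      mul_mem_right' := fun a _ hx => ⟨I.mul_mem_right' a hx.1, J.mul_mem_right' a hx.2⟩
      isClosed' := I.isClosed'.inter J.isClosed' }

/-- The intersection of a family of ideals. -/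
instance : InfSet (ClosedIdeal A) where
  sInf S :=
    { carrier := {x | ∀ I ∈ S, x ∈ I}
      add_mem' := fun hx hy I hI => I.add_mem' (hx I hI) (hy I hI)
      zero_mem' := fun I _ => I.zero_mem'
      smul_mem' := fun c _ hx I hI => I.smul_mem' c (hx I hI)
      mul_mem_left' := fun a _ hx I hI => I.mul_mem_left' a (hx I hI)
      mul_mem_right' := fun a _ hx I hI => I.mul_mem_right' a (hx I hI)
      isClosed' := by
        have : {x : A | ∀ I ∈ S, x ∈ I} = ⋂ I ∈ S, (I : Set A) := by
          ext x
          simp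
        rw [this]
        exact isClosed_biInter fun I _ => I.isClosed }

theorem mem_top (x : A) : x ∈ (⊤ : ClosedIdeal A) := trivial

theorem mem_bot {x : A} : x ∈ (⊥ : ClosedIdeal A) ↔ x = 0 := Iff.rfl

theorem mem_inf {I J : ClosedIdeal A} {x : A} : x ∈ I ⊓ J ↔ x ∈ I ∧ x ∈ J := Iff.rfl

theorem mem_sInf {S : Set (ClosedIdeal A)} {x : A} : x ∈ sInf S ↔ ∀ I ∈ S, x ∈ I := Iff.rfl

/-- The ideal lattice is complete: infima are intersections, and the supremum of a family is the
smallest closed two-sided ideal that contains it. -/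
instance : CompleteLattice (ClosedIdeal A) where
  __ := completeLatticeOfInf (ClosedIdeal A) fun S =>
    ⟨fun I hI _ hx => mem_sInf.1 hx I hI, fun _ hJ _ hx => mem_sInf.2 fun _ hI => hJ hI hx⟩
  inf := (· ⊓ ·)
  inf_le_left _ _ _ hx := hx.1
  inf_le_right _ _ _ hx := hx.2
  le_inf _ _ _ h₁ h₂ _ hx := ⟨h₁ hx, h₂ hx⟩
  top := ⊤
  le_top _ _ _ := trivial
  bot := ⊥
  bot_le I x hx := by
    rw [mem_bot.1 hx]
    exact I.zero_mem'

end ClosedIdeal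

/-! ### The primitive ideal space -/

/-- A representation of a C*-algebra on a Hilbert space is irreducible if it is non-zero and has
no closed invariant subspaces other than `0` and the whole space. -/
def IsIrreducibleRep {A : Type u} [NonUnitalCStarAlgebra A] {H : Type v} [NormedAddCommGroup H]
    [InnerProductSpace ℂ H] [CompleteSpace H] (π : A →⋆ₙₐ[ℂ] (H →L[ℂ] H)) : Prop :=
  (∃ a, π a ≠ 0) ∧
    ∀ K : Submodule ℂ H, IsClosed (K : Set H) → (∀ a, ∀ ξ ∈ K, π a ξ ∈ K) → K = ⊥ ∨ K = ⊤

/-- A primitive ideal is the kernel of an irreducible representation. The Hilbert space of an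
irreducible representation `π` is `π(A) ξ` for any vector `ξ ≠ 0` (Kadison transitivity), so that
up to unitary equivalence it lives in the universe of `A`. -/
def ClosedIdeal.IsPrimitive {A : Type u} [NonUnitalCStarAlgebra A] (P : ClosedIdeal A) : Prop :=
  ∃ (H : Type u) (_ : NormedAddCommGroup H) (_ : InnerProductSpace ℂ H) (_ : CompleteSpace H)
    (π : A →⋆ₙₐ[ℂ] (H →L[ℂ] H)), IsIrreducibleRep π ∧ ∀ a, a ∈ P ↔ π a = 0

theorem ClosedIdeal.IsPrimitive.ne_top {A : Type u} [NonUnitalCStarAlgebra A] {P : ClosedIdeal A}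
    (hP : P.IsPrimitive) : P ≠ ⊤ := by
  rintro rfl
  obtain ⟨H, _, _, _, π, ⟨⟨a, ha⟩, -⟩, hπ⟩ := hP
  exact ha ((hπ a).1 (ClosedIdeal.mem_top a))

/-- Primitive ideals are prime. -/
theorem ClosedIdeal.IsPrimitive.le_or_le {A : Type u} [NonUnitalCStarAlgebra A]
    {P : ClosedIdeal A} (hP : P.IsPrimitive) {I J : ClosedIdeal A} (h : I ⊓ J ≤ P) :
    I ≤ P ∨ J ≤ P := by
  obtain ⟨H, _, _, _, π, ⟨-, hirr⟩, hπ⟩ := hP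
  let N : Submodule ℂ H := Submodule.span ℂ {η | ∃ y ∈ J, ∃ ξ : H, π y ξ = η}
  have hN : ∀ a, ∀ η ∈ N, π a η ∈ N := by
    intro a η hη
    induction hη using Submodule.span_induction with
    | mem η h =>
      obtain ⟨y, hy, ξ, rfl⟩ := h
      exact Submodule.subset_span ⟨a * y, J.mul_mem_left a hy, ξ, by simp⟩
    | zero => simp
    | add η ζ _ _ h₁ h₂ =>
      rw [map_add]
      exact N.add_mem h₁ h₂
    | smul c η _ h =>
      rw [map_smul]
      exact N.smul_mem c h
  rcases hirr N.topologicalClosure N.isClosed_topologicalClosure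
    (fun a η hη => map_mem_closure (π a).continuous hη (hN a)) with hK | hK
  · right
    intro y hy
    refine (hπ y).2 (ContinuousLinearMap.ext fun ξ => ?_)
    have : π y ξ ∈ N.topologicalClosure :=
      N.le_topologicalClosure (Submodule.subset_span ⟨y, hy, ξ, rfl⟩)
    rw [hK] at this
    simpa using this
  · left
    intro x hx
    have hker : N ≤ LinearMap.ker (π x).toLinearMap := by
      refine Submodule.span_le.2 ?_
      rintro _ ⟨y, hy, ξ, rfl⟩
      have : π (x * y) = 0 := (hπ _).1 (h ⟨I.mul_mem_right y hx, J.mul_mem_left x hy⟩)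
      rw [map_mul] at this
      exact DFunLike.congr_fun this ξ
    refine (hπ x).2 (ContinuousLinearMap.ext fun ξ => ?_)
    have hξ : ξ ∈ N.topologicalClosure := by
      rw [hK]
      trivial
    exact N.topologicalClosure_minimal hker (π x).isClosed_ker hξ

/-- The set of primitive ideals of a C*-algebra. -/
def PrimitiveIdealSpace (A : Type u) [NonUnitalCStarAlgebra A] : Type u :=
  {P : ClosedIdeal A // P.IsPrimitive}

/-- The hull-kernel (Jacobson) topology: the open sets are the complements of the hulls
`{P | I ⊆ P}` of the closed two-sided ideals `I`. -/
instance {A : Type u} [NonUnitalCStarAlgebra A] : TopologicalSpace (PrimitiveIdealSpace A) where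
  IsOpen U := ∃ I : ClosedIdeal A, U = {P | ¬ I ≤ P.1}
  isOpen_univ := by
    refine ⟨⊤, (Set.eq_univ_of_forall fun P h => ?_).symm⟩
    exact P.2.ne_top (top_le_iff.1 h)
  isOpen_inter := by
    rintro _ _ ⟨I, rfl⟩ ⟨J, rfl⟩
    refine ⟨I ⊓ J, Set.ext fun P => ⟨fun h hIJ => ?_, fun h => ⟨fun hI => ?_, fun hJ => ?_⟩⟩⟩
    · exact (P.2.le_or_le hIJ).elim h.1 h.2
    · exact h (inf_le_left.trans hI)
    · exact h (inf_le_right.trans hJ)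
  isOpen_sUnion := by
    intro S hS
    refine ⟨sSup {I | {P : PrimitiveIdealSpace A | ¬ I ≤ P.1} ∈ S}, Set.ext fun P => ?_⟩
    simp only [Set.mem_sUnion, Set.mem_ofPred_eq, sSup_le_iff, not_forall]
    constructor
    · rintro ⟨U, hU, hP⟩
      obtain ⟨I, rfl⟩ := hS U hU
      exact ⟨I, hU, hP⟩
    · rintro ⟨I, hI, hP⟩
      exact ⟨_, hI, hP⟩

/-!
A sup-preserving map `Φ : L → [0, 1]` on a complete lattice is the lower adjoint of a map
`G : [0, 1] → L`, `Φ x ≤ t ↔ x ≤ G t`, and if `L` is a continuous lattice and `G` has no jumps, in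
the sense that `G t = sup {G s | s < t}` for all `t` (at `t = 0` this reads `G 0 = ⊥`), then `Φ`
preserves compact containment and vanishes at `⊥` only. So what is needed is a densely ordered chain
in `L` from `⊥` to `⊤` that is closed under suprema and infima (`IsContinuousChain`) and has a
countable order dense subset: by Cantor's theorem that subset can be labelled by the rational numbers
in `(0, 1)`, and the labels define `Φ` (`IsContinuousChain.exists_isCuMorphism`).

A maximal chain in `L` may have jumps. The right chain is a maximal one among the elements `c` for
which `[c, ⊤]` has no compact elements except `c` (`NoRelCompact c`). The hypothesis says that `⊥` is
such an element. These elements are closed under infima and directed suprema, so that a maximal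
chain of them is closed under suprema and infima. They are order dense
(`NoRelCompact.exists_between`): given `a < b`, choose `x` compactly contained in `b` with `¬ x ≤ a`,
and let `c` be the supremum of the compact elements of `[a ⊔ x, ⊤]`. It has no compact elements
over it (`noRelCompact_sSup_relCompact`) and `a < c ≤ b`. Were `c = b`, a compact element of
`[a ⊔ x, ⊤]` would dominate some `v` in which `x` is compactly contained, and so would be compact over
`a`, which is impossible.

For the ideal lattice of a C⋆-algebra three facts remain. Separability gives the countable order
dense subset of the chain. The lattice is continuous (`ClosedIdeal.isContinuousLattice`): if
`e * h = h` with `e ∈ J`, then the ideal generated by `h` is compactly contained in `J`, since an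
element `y` near `e` satisfies `y * h = (1 - (e - y)) * h`; and such `h` are provided by functional
calculus. Finally, a compact element of the lattice gives a compact open set of primitive ideals,
which rests on every closed ideal being an intersection of primitive ideals
(`ClosedIdeal.exists_isPrimitive`). For the latter, pass to the unitization: for `x ∉ J` the
Hahn-Banach theorem separates `-x⋆x` from the closure of the positive cone plus `J`, which gives a
state that is zero on `J` and not on `x⋆x`; by the Krein-Milman theorem there is an extreme such
state, and its GNS representation is irreducible. The quotient C⋆-algebra is not needed: the cutoff
functions of `IsSelfAdjoint.exists_cutoff` replace approximate units of `J`.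
-/

/-! ### Compact containment in a continuous lattice -/

section Lattice

variable {L : Type u} [CompleteLattice L]

theorem CompactlyContained.le {x y : L} (h : CompactlyContained x y) : x ≤ y := by
  obtain ⟨d, rfl, hd⟩ := h {y} (Set.singleton_nonempty y) (directedOn_singleton y)
    (by simp)
  exact hd

theorem CompactlyContained.mono {x x' y y' : L} (h : CompactlyContained x y) (hx : x' ≤ x)
    (hy : y ≤ y') : CompactlyContained x' y' := fun D hne hD hy' =>
  let ⟨d, hd, hxd⟩ := h D hne hD (hy.trans hy')
  ⟨d, hd, hx.trans hxd⟩

theorem CompactlyContained.sup {x x' y : L} (h : CompactlyContained x y)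
    (h' : CompactlyContained x' y) : CompactlyContained (x ⊔ x') y := by
  intro D hne hD hy
  obtain ⟨d, hd, hxd⟩ := h D hne hD hy
  obtain ⟨d', hd', hxd'⟩ := h' D hne hD hy
  obtain ⟨e, he, hde, hde'⟩ := hD d hd d' hd'
  exact ⟨e, he, sup_le (hxd.trans hde) (hxd'.trans hde')⟩

theorem CompactlyContained.bot (y : L) : CompactlyContained ⊥ y := fun _ hne _ _ =>
  let ⟨d, hd⟩ := hne
  ⟨d, hd, bot_le⟩

/-- A continuous lattice: every element is determined by the elements compactly contained
in it. -/
def IsContinuousLattice (L : Type u) [CompleteLattice L] : Prop :=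
  ∀ x y : L, (∀ u, CompactlyContained u x → u ≤ y) → x ≤ y

/-- Interpolation for compact containment in a continuous lattice. -/
theorem IsContinuousLattice.exists_between (hL : IsContinuousLattice L) {u w : L}
    (h : CompactlyContained u w) :
    ∃ v, CompactlyContained u v ∧ CompactlyContained v w := by
  obtain ⟨u', ⟨v, hu', hv⟩, hu⟩ :=
    h {u' | ∃ v, CompactlyContained u' v ∧ CompactlyContained v w}
      ⟨⊥, ⊥, .bot _, .bot _⟩
      (by
        rintro a ⟨v, hav, hv⟩ b ⟨v', hbv, hv'⟩
        exact ⟨a ⊔ b, ⟨v ⊔ v', (hav.mono le_rfl le_sup_left).sup (hbv.mono le_rfl le_sup_right),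
          hv.sup hv'⟩, le_sup_left, le_sup_right⟩)
      (hL _ _ fun v hv => hL _ _ fun u' hu' => le_sSup ⟨v, hu', hv⟩)
  exact ⟨v, hu'.mono hu le_rfl, hv⟩

/-! ### Relatively compact elements -/

/-- `w` is a compact element of the interval `[c, ⊤]`. -/
def RelCompact (c w : L) : Prop :=
  c ≤ w ∧ ∀ D : Set L, D.Nonempty → DirectedOn (· ≤ ·) D → (∀ d ∈ D, c ≤ d) → w ≤ sSup D →
    ∃ d ∈ D, w ≤ d

theorem RelCompact.refl (c : L) : RelCompact c c :=
  ⟨le_rfl, fun _ ⟨d, hd⟩ _ hc _ => ⟨d, hd, hc d hd⟩⟩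

theorem RelCompact.sup {c w w' : L} (h : RelCompact c w) (h' : RelCompact c w') :
    RelCompact c (w ⊔ w') := by
  refine ⟨h.1.trans le_sup_left, fun D hne hD hc hw => ?_⟩
  obtain ⟨d, hd, hwd⟩ := h.2 D hne hD hc (le_sup_left.trans hw)
  obtain ⟨d', hd', hwd'⟩ := h'.2 D hne hD hc (le_sup_right.trans hw)
  obtain ⟨e, he, hde, hde'⟩ := hD d hd d' hd'
  exact ⟨e, he, sup_le (hwd.trans hde) (hwd'.trans hde')⟩

theorem directedOn_relCompact (c : L) : DirectedOn (· ≤ ·) {w | RelCompact c w} :=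
  fun _ hu _ hv => ⟨_, RelCompact.sup hu hv, le_sup_left, le_sup_right⟩

/-- If some member of every directed set with supremum above `w` dominates `c`, then compactness
of `w` relative to `c` is compactness of `w` relative to any smaller element. -/
theorem RelCompact.of_exists_le {b c w : L} (h : RelCompact c w) (hbc : b ≤ c)
    (H : ∀ D : Set L, D.Nonempty → DirectedOn (· ≤ ·) D → (∀ d ∈ D, b ≤ d) → w ≤ sSup D →
      ∃ d ∈ D, c ≤ d) : RelCompact b w := by
  refine ⟨hbc.trans h.1, fun D hne hD hb hw => ?_⟩
  obtain ⟨d₀, hd₀, hcd₀⟩ := H D hne hD hb hw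
  obtain ⟨d, hd, hwd⟩ := h.2 {d ∈ D | c ≤ d} ⟨d₀, hd₀, hcd₀⟩
    (by
      rintro x ⟨hx, hcx⟩ y ⟨hy, -⟩
      obtain ⟨z, hz, hxz, hyz⟩ := hD x hx y hy
      exact ⟨z, ⟨hz, hcx.trans hxz⟩, hxz, hyz⟩)
    (fun d hd => hd.2)
    (hw.trans (sSup_le fun x hx => by
      obtain ⟨z, hz, hxz, hyz⟩ := hD x hx d₀ hd₀
      exact hxz.trans (le_sSup ⟨hz, hcd₀.trans hyz⟩)))
  exact ⟨d, hd.1, hwd⟩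

theorem RelCompact.trans {b c w : L} (h : RelCompact b c) (h' : RelCompact c w) :
    RelCompact b w :=
  h'.of_exists_le h.1 fun D hne hD hb hw => h.2 D hne hD hb (h'.1.trans hw)

theorem RelCompact.sup_left {c w n : L} (h : RelCompact c w) (hcn : c ≤ n) :
    RelCompact n (n ⊔ w) := by
  refine ⟨le_sup_left, fun D hne hD hn hw => ?_⟩
  obtain ⟨d, hd, hwd⟩ := h.2 D hne hD (fun d hd => hcn.trans (hn d hd)) (le_sup_right.trans hw)
  exact ⟨d, hd, sup_le (hn d hd) hwd⟩

theorem CompactlyContained.relCompact {c x x' : L} (h : CompactlyContained x x')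
    (hx' : x' ≤ c ⊔ x) : RelCompact c (c ⊔ x) := by
  refine ⟨le_sup_left, fun D hne hD hc hw => ?_⟩
  obtain ⟨d, hd, hxd⟩ := h D hne hD (hx'.trans hw)
  exact ⟨d, hd, sup_le (hc d hd) hxd⟩

/-- A compact element over a directed supremum comes from a compact element over one of the
members of the directed set. -/
theorem RelCompact.exists_of_sSup (hL : IsContinuousLattice L) {T : Set L} (hne : T.Nonempty)
    (hT : DirectedOn (· ≤ ·) T) {w : L} (h : RelCompact (sSup T) w) :
    ∃ t ∈ T, ∃ x, w = sSup T ⊔ x ∧ RelCompact t (t ⊔ x) := by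
  obtain ⟨_, ⟨x, hx, rfl⟩, hwx⟩ := h.2 ((fun x => sSup T ⊔ x) '' {x | CompactlyContained x w})
    ⟨_, ⊥, .bot w, rfl⟩
    (by
      rintro _ ⟨x, hx, rfl⟩ _ ⟨y, hy, rfl⟩
      exact ⟨_, ⟨_, hx.sup hy, rfl⟩, sup_le_sup_left le_sup_left _,
        sup_le_sup_left le_sup_right _⟩)
    (by
      rintro _ ⟨x, hx, rfl⟩
      exact le_sup_left)
    (hL _ _ fun x hx => le_sup_right.trans (le_sSup ⟨x, hx, rfl⟩))
  have hw : w = sSup T ⊔ x := hwx.antisymm (sup_le h.1 (CompactlyContained.le hx))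
  obtain ⟨x', hxx', hx'⟩ := hL.exists_between hx
  obtain ⟨_, ⟨t, ht, rfl⟩, hxt⟩ := hx' ((fun t => t ⊔ x) '' T) (hne.image _)
    (by
      rintro _ ⟨s, hs, rfl⟩ _ ⟨t, ht, rfl⟩
      obtain ⟨r, hr, hsr, htr⟩ := hT s hs t ht
      exact ⟨_, ⟨r, hr, rfl⟩, sup_le_sup_right hsr _, sup_le_sup_right htr _⟩)
    (by
      obtain ⟨t, ht⟩ := hne
      exact hwx.trans (sup_le (sSup_le fun t ht => le_sup_left.trans (le_sSup ⟨t, ht, rfl⟩))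
        ((le_sup_right (a := t)).trans (le_sSup ⟨t, ht, rfl⟩))))
  exact ⟨t, ht, x, hw, hxx'.relCompact hxt⟩

/-! ### Elements without compact elements above them -/

/-- The interval `[c, ⊤]` has no compact elements other than `c`. If `L` is the ideal lattice of
a C⋆-algebra, this says that the primitive ideal space of the quotient by `c` has no non-empty
compact open subsets. -/
def NoRelCompact (c : L) : Prop := ∀ w, RelCompact c w → w ≤ c

theorem noRelCompact_bot (h : ∀ x : L, CompactlyContained x x → x = ⊥) :
    NoRelCompact (⊥ : L) := fun w hw =>
  (h w fun D hne hD hwD => hw.2 D hne hD (fun _ _ => bot_le) hwD).le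

theorem noRelCompact_sInf {S : Set L} (hS : ∀ n ∈ S, NoRelCompact n) : NoRelCompact (sInf S) :=
  fun _ hw => le_sInf fun n hn => le_sup_right.trans (hS n hn _ (hw.sup_left (sInf_le hn)))

theorem noRelCompact_sSup (hL : IsContinuousLattice L) {T : Set L} (hne : T.Nonempty)
    (hT : DirectedOn (· ≤ ·) T) (h : ∀ t ∈ T, NoRelCompact t) : NoRelCompact (sSup T) := by
  intro w hw
  obtain ⟨t, ht, x, rfl, hx⟩ := hw.exists_of_sSup hL hne hT
  exact sup_le le_rfl (le_sup_right.trans ((h t ht _ hx).trans (le_sSup ht)))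

/-- Joining all compact elements over `c` yields an element without compact elements over it: no
transfinite iteration is necessary. -/
theorem noRelCompact_sSup_relCompact (hL : IsContinuousLattice L) (c : L) :
    NoRelCompact (sSup {w | RelCompact c w}) := by
  intro w hw
  obtain ⟨t, ht, x, rfl, hx⟩ := hw.exists_of_sSup hL ⟨c, .refl c⟩ (directedOn_relCompact c)
  exact sup_le le_rfl (le_sup_right.trans (le_sSup (RelCompact.trans ht hx)))

/-- The elements without compact elements over them are order dense. -/
theorem NoRelCompact.exists_between (hL : IsContinuousLattice L) {a b : L} (ha : NoRelCompact a)
    (hb : NoRelCompact b) (hab : a < b) : ∃ c, NoRelCompact c ∧ a < c ∧ c < b := by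
  obtain ⟨x, hxb, hxa⟩ : ∃ x, CompactlyContained x b ∧ ¬ x ≤ a := by
    by_contra! h
    exact hab.not_ge (hL _ _ h)
  refine ⟨sSup {w | RelCompact (a ⊔ x) w}, noRelCompact_sSup_relCompact hL _, ?_, ?_⟩
  · have h : a ⊔ x ≤ sSup {w | RelCompact (a ⊔ x) w} := le_sSup (RelCompact.refl _)
    exact lt_of_le_not_ge (le_sup_left.trans h) fun h' => hxa (le_sup_right.trans (h.trans h'))
  · refine lt_of_le_not_ge (sSup_le fun w hw => ?_) fun hbE => ?_
    · exact le_sup_right.trans (hb _ (hw.sup_left (sup_le hab.le hxb.le)))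
    -- Otherwise a compact element `w` over `a ⊔ x` dominates some `v` in which `x` is
    -- compactly contained, and this makes `w` compact over `a`.
    obtain ⟨v, hxv, hvb⟩ := hL.exists_between hxb
    obtain ⟨w, hw, hvw⟩ := hvb _ ⟨_, RelCompact.refl _⟩ (directedOn_relCompact _) hbE
    have : RelCompact a w := RelCompact.of_exists_le hw le_sup_left fun D hne hD hb hwD =>
      let ⟨d, hd, hxd⟩ := hxv D hne hD (hvw.trans hwD)
      ⟨d, hd, sup_le (hb d hd) hxd⟩
    exact hxa (le_sup_right.trans (hw.1.trans (ha w this)))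

/-! ### Continuous chains -/

/-- A densely ordered chain from `⊥` to `⊤` that is closed under the suprema and infima of the
ambient complete lattice. -/
structure IsContinuousChain (C : Set L) : Prop where
  le_or_le : ∀ a ∈ C, ∀ b ∈ C, a ≤ b ∨ b ≤ a
  sSup_mem : ∀ S ⊆ C, sSup S ∈ C
  sInf_mem : ∀ S ⊆ C, sInf S ∈ C
  exists_between : ∀ a ∈ C, ∀ b ∈ C, a < b → ∃ c ∈ C, a < c ∧ c < b

/-- The chain is a maximal chain of elements without compact elements over them. -/
theorem exists_isContinuousChain (hL : IsContinuousLattice L)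
    (h : ∀ x : L, CompactlyContained x x → x = ⊥) : ∃ C : Set L, IsContinuousChain C := by
  obtain ⟨F⟩ : Nonempty (Flag {c : L // NoRelCompact c}) := inferInstance
  let C : Set L := Subtype.val '' (F : Set {c : L // NoRelCompact c})
  have hchain : ∀ a ∈ C, ∀ b ∈ C, a ≤ b ∨ b ≤ a := by
    rintro _ ⟨a, ha, rfl⟩ _ ⟨b, hb, rfl⟩
    exact F.le_or_le ha hb
  have hmem : ∀ a, NoRelCompact a → (∀ b ∈ C, a ≤ b ∨ b ≤ a) → a ∈ C := fun a ha hab =>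
    ⟨⟨a, ha⟩, Flag.mem_iff_forall_le_or_ge.2 fun b hb => hab _ ⟨b, hb, rfl⟩, rfl⟩
  have hN : ∀ a ∈ C, NoRelCompact a := by
    rintro _ ⟨a, -, rfl⟩
    exact a.2
  refine ⟨C, hchain, fun S hS => ?_, fun S hS => ?_, fun a ha b hb hab => ?_⟩
  · refine hmem _ ?_ fun b hb => ?_
    · rcases S.eq_empty_or_nonempty with rfl | hne
      · rw [sSup_empty]
        exact noRelCompact_bot h
      · refine noRelCompact_sSup hL hne (fun a ha b hb => ?_) fun t ht => hN t (hS ht)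
        rcases hchain a (hS ha) b (hS hb) with hab | hab
        exacts [⟨b, hb, hab, le_rfl⟩, ⟨a, ha, le_rfl, hab⟩]
    · by_cases hSb : ∀ s ∈ S, s ≤ b
      · exact .inl (sSup_le hSb)
      · push Not at hSb
        obtain ⟨s, hs, hsb⟩ := hSb
        exact .inr (((hchain s (hS hs) b hb).resolve_left hsb).trans (le_sSup hs))
  · refine hmem _ (noRelCompact_sInf fun n hn => hN n (hS hn)) fun b hb => ?_
    by_cases hSb : ∀ s ∈ S, b ≤ s
    · exact .inr (le_sInf hSb)
    · push Not at hSb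
      obtain ⟨s, hs, hsb⟩ := hSb
      exact .inl ((sInf_le hs).trans ((hchain s (hS hs) b hb).resolve_right hsb))
  · obtain ⟨c, hc, hac, hcb⟩ := (hN a ha).exists_between hL (hN b hb) hab
    by_cases hcC : c ∈ C
    · exact ⟨c, hcC, hac, hcb⟩
    have : ¬ ∀ x ∈ C, c ≤ x ∨ x ≤ c := fun H => hcC (hmem c hc H)
    push Not at this
    obtain ⟨x, hx, hcx, hxc⟩ := this
    refine ⟨x, hx, ?_, ?_⟩
    · exact lt_of_le_not_ge ((hchain a ha x hx).resolve_right fun hxa => hxc (hxa.trans hac.le))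
        fun hxa => hxc (hxa.trans hac.le)
    · exact lt_of_le_not_ge ((hchain x hx b hb).resolve_right fun hbx => hcx (hcb.le.trans hbx))
        fun hbx => hcx (hcb.le.trans hbx)

theorem unitInterval_compactlyContained {s t : unitInterval} (h : s = 0 ∨ s < t) :
    CompactlyContained s t := by
  intro D hne hD ht
  rcases h with rfl | h
  · obtain ⟨d, hd⟩ := hne
    exact ⟨d, hd, d.2.1⟩
  · obtain ⟨d, hd, hsd⟩ := lt_sSup_iff.1 (h.trans_le ht)
    exact ⟨d, hd, hsd.le⟩

/-- A countable order dense set of elements strictly inside of a continuous chain can be labelled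
by the rational numbers in `(0, 1)`. -/
theorem IsContinuousChain.exists_labelling [Nontrivial L] {C : Set L} (hC : IsContinuousChain C)
    {ι : Type*} [Countable ι] (q : ι → L) (hqC : ∀ i, q i ∈ C)
    (hq : ∀ a ∈ C, ∀ b ∈ C, a < b → ∃ i, a ≤ q i ∧ q i ≤ b) :
    ∃ (Q : Set L) (e : Q → unitInterval), Q ⊆ C ∧ (∀ x y, e x < e y ↔ (x : L) < y) ∧
      (∀ s t, s < t → ∃ x, s < e x ∧ e x < t) ∧
      ∀ a ∈ C, ∀ b ∈ C, a < b → ∃ x ∈ Q, a < x ∧ x < b := by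
  classical
  let Q : Set L := {x | x ∈ Set.range q ∧ x ≠ ⊥ ∧ x ≠ ⊤}
  have hQC : Q ⊆ C := by
    rintro _ ⟨⟨i, rfl⟩, -⟩
    exact hqC i
  have hbot : (⊥ : L) ∈ C := sSup_empty (α := L) ▸ hC.sSup_mem ∅ (Set.empty_subset _)
  have htop : (⊤ : L) ∈ C := sInf_empty (α := L) ▸ hC.sInf_mem ∅ (Set.empty_subset _)
  have hdense : ∀ a ∈ C, ∀ b ∈ C, a < b → ∃ x ∈ Q, a < x ∧ x < b := by
    intro a ha b hb hab
    obtain ⟨c, hc, hac, hcb⟩ := hC.exists_between a ha b hb hab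
    obtain ⟨d, hd, hcd, hdb⟩ := hC.exists_between c hc b hb hcb
    obtain ⟨i, hci, hid⟩ := hq c hc d hd hcd
    have h₁ := hac.trans_le hci
    have h₂ := hid.trans_lt hdb
    exact ⟨q i, ⟨⟨i, rfl⟩, h₁.ne_bot, h₂.ne_top⟩, h₁, h₂⟩
  let _ : LinearOrder Q :=
    { (inferInstance : PartialOrder Q) with
      le_total := fun x y => hC.le_or_le _ (hQC x.2) _ (hQC y.2)
      toDecidableLE := Classical.decRel _ }
  have : Countable Q := ((Set.countable_range q).mono fun x hx => hx.1).to_subtype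
  have : DenselyOrdered Q := ⟨fun x y hxy => by
    obtain ⟨z, hz, h₁, h₂⟩ := hdense _ (hQC x.2) _ (hQC y.2) hxy
    exact ⟨⟨z, hz⟩, h₁, h₂⟩⟩
  have : NoMinOrder Q := ⟨fun x => by
    obtain ⟨z, hz, -, h⟩ := hdense _ hbot _ (hQC x.2) (bot_lt_iff_ne_bot.2 x.2.2.1)
    exact ⟨⟨z, hz⟩, h⟩⟩
  have : NoMaxOrder Q := ⟨fun x => by
    obtain ⟨z, hz, h, -⟩ := hdense _ (hQC x.2) _ htop (lt_top_iff_ne_top.2 x.2.2.2)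
    exact ⟨⟨z, hz⟩, h⟩⟩
  have : Nonempty Q := by
    obtain ⟨z, hz, -⟩ := hdense _ hbot _ htop bot_lt_top
    exact ⟨⟨z, hz⟩⟩
  have : Nonempty (Set.Ioo (0 : ℚ) 1) := ⟨⟨1 / 2, by norm_num, by norm_num⟩⟩
  obtain ⟨e⟩ := Order.iso_of_countable_dense Q (Set.Ioo (0 : ℚ) 1)
  refine ⟨Q, fun x => ⟨((e x : ℚ) : ℝ), by exact_mod_cast (e x).2.1.le,
    by exact_mod_cast (e x).2.2.le⟩, hQC, fun x y => ?_, fun s t hst => ?_, hdense⟩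
  · change ((e x : ℚ) : ℝ) < (e y : ℚ) ↔ x < y
    rw [Rat.cast_lt, Subtype.coe_lt_coe, e.lt_iff_lt]
  · obtain ⟨r, hsr, hrt⟩ := exists_rat_btwn (Subtype.coe_lt_coe.2 hst)
    have h0 : (0 : ℚ) < r := by exact_mod_cast s.2.1.trans_lt hsr
    have h1 : r < 1 := by exact_mod_cast hrt.trans_le t.2.2
    refine ⟨e.symm ⟨r, h0, h1⟩, ?_, ?_⟩
    · rw [← Subtype.coe_lt_coe]
      simpa using hsr
    · rw [← Subtype.coe_lt_coe]
      simpa using hrt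

/-- A continuous chain, reparametrized by `[0, 1]`, is the upper adjoint of a Cu-morphism. -/
theorem IsContinuousChain.exists_isCuMorphism {C : Set L}
    (hC : IsContinuousChain C) {ι : Type*} [Countable ι] (q : ι → L) (hqC : ∀ i, q i ∈ C)
    (hq : ∀ a ∈ C, ∀ b ∈ C, a < b → ∃ i, a ≤ q i ∧ q i ≤ b) :
    ∃ Φ : L → unitInterval, IsCuMorphism Φ ∧ Φ ⁻¹' {0} = {⊥} := by
  rcases subsingleton_or_nontrivial L with hsub | hnon
  · refine ⟨fun _ => 0, ⟨monotone_const, fun S => ?_, fun _ _ _ =>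
      unitInterval_compactlyContained (.inl rfl)⟩, Set.ext fun x => ?_⟩
    · have h : sSup ((fun _ : L => (0 : unitInterval)) '' S) ≤ ⊥ := sSup_le (by
        rintro _ ⟨x, -, rfl⟩
        exact le_rfl)
      exact (le_bot_iff.1 h).symm
    · simp [Subsingleton.elim x ⊥]
  obtain ⟨Q, e, hQC, he, hdense, hQ⟩ := hC.exists_labelling q hqC hq
  let Φ : L → unitInterval := fun J => sInf {t | ∃ x : Q, J ≤ x ∧ t = e x}
  let G : unitInterval → L := fun t => sInf {y : L | ∃ x : Q, t < e x ∧ y = x}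
  have hGC : ∀ t, G t ∈ C := fun t => hC.sInf_mem _ (by
    rintro _ ⟨x, -, rfl⟩
    exact hQC x.2)
  have hgc : GaloisConnection Φ G := by
    intro J t
    constructor
    · refine fun h => le_sInf ?_
      rintro _ ⟨x, hx, rfl⟩
      obtain ⟨_, ⟨y, hy, rfl⟩, hyx⟩ := sInf_lt_iff.1 (h.trans_lt hx)
      exact le_trans hy ((he y x).1 hyx).le
    · refine fun h => le_of_forall_gt_imp_ge_of_dense fun s hs => ?_
      obtain ⟨x, htx, hxs⟩ := hdense t s hs
      have hGx : G t ≤ x := sInf_le ⟨x, htx, rfl⟩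
      have hΦx : Φ J ≤ e x := sInf_le ⟨x, h.trans hGx, rfl⟩
      exact hΦx.trans hxs.le
  -- The chain has no jumps, so that `G` may be computed from below as well as from above.
  have hG : ∀ t, G t = sSup {y : L | ∃ x : Q, e x < t ∧ y = x} := by
    intro t
    refine le_antisymm ?_ (sSup_le ?_)
    · by_contra hlt
      have hC' : sSup {y : L | ∃ x : Q, e x < t ∧ y = x} ∈ C := hC.sSup_mem _ (by
        rintro _ ⟨x, -, rfl⟩
        exact hQC x.2)
      have hlt := lt_of_le_not_ge ((hC.le_or_le _ hC' _ (hGC t)).resolve_right hlt) hlt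
      obtain ⟨x, hx, h₁, h₂⟩ := hQ _ hC' _ (hGC t) hlt
      obtain ⟨y, hy, h₃, h₄⟩ := hQ _ (hQC hx) _ (hGC t) h₂
      have hxt : t ≤ e ⟨x, hx⟩ := by
        refine not_lt.1 fun h => h₁.not_ge ?_
        exact le_sSup ⟨⟨x, hx⟩, h, rfl⟩
      refine h₄.not_ge ?_
      exact sInf_le ⟨⟨y, hy⟩, hxt.trans_lt ((he ⟨x, hx⟩ ⟨y, hy⟩).2 h₃), rfl⟩
    · rintro _ ⟨x, hx, rfl⟩
      refine le_sInf ?_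
      rintro _ ⟨y, hy, rfl⟩
      exact ((he x y).1 (hx.trans hy)).le
  have hG0 : G 0 = ⊥ := by
    rw [hG, ← le_bot_iff]
    refine sSup_le ?_
    rintro _ ⟨x, hx, rfl⟩
    exact absurd hx (not_lt.2 (e x).2.1)
  have hΦ0 : ∀ J, Φ J = 0 ↔ J = ⊥ := fun J => by
    rw [← le_bot_iff (a := J), ← hG0, ← hgc J 0]
    exact ⟨fun h => h.le, fun h => le_antisymm h (Φ J).2.1⟩
  refine ⟨Φ, ⟨hgc.monotone_l, fun S => ?_, fun I J hIJ => ?_⟩, Set.ext fun J => hΦ0 J⟩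
  · rw [hgc.l_sSup, sSup_image]
  · refine unitInterval_compactlyContained (or_iff_not_imp_left.2 fun hI => ?_)
    have hJ : J ≤ G (Φ J) := hgc.le_u_l J
    rw [hG] at hJ
    have hJ0 : 0 < Φ J := lt_of_le_of_ne (Φ J).2.1 fun h => hI ((hΦ0 I).2 (by
      rw [← le_bot_iff, ← (hΦ0 J).1 h.symm]
      exact hIJ.le))
    obtain ⟨_, ⟨x, hx, rfl⟩, hIx⟩ := hIJ {y : L | ∃ x : Q, e x < Φ J ∧ y = x}
      (by
        obtain ⟨x, -, hx⟩ := hdense 0 _ hJ0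
        exact ⟨x, x, hx, rfl⟩)
      (by
        rintro _ ⟨x, hx, rfl⟩ _ ⟨y, hy, rfl⟩
        rcases hC.le_or_le _ (hQC x.2) _ (hQC y.2) with h | h
        exacts [⟨y, ⟨y, hy, rfl⟩, h, le_rfl⟩, ⟨x, ⟨x, hx, rfl⟩, le_rfl, h⟩])
      hJ
    exact (sInf_le ⟨x, hIx, rfl⟩ : Φ I ≤ e x).trans_lt hx

end Lattice

/-! ### Ideals and states of a unital C⋆-algebra -/

theorem ClosedIdeal.smul_mem_real {A : Type u} [NonUnitalCStarAlgebra A] (J : ClosedIdeal A) (r : ℝ)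
    {x : A} (hx : x ∈ J) :
    r • x ∈ J := by
  rw [← Complex.coe_smul]
  exact J.smul_mem' _ hx

section Unital

open scoped ComplexOrder

variable {B : Type u} [CStarAlgebra B] [PartialOrder B] [StarOrderedRing B]

/-- Functional calculus with `t ↦ ε / max t ε` and `t ↦ 1 / max t ε`. The element `d` cuts off the
part of `s` above `ε`, while `1 - d` lives on that part, where `s` is invertible. -/
theorem IsSelfAdjoint.exists_cutoff {s : B} (hs : IsSelfAdjoint s) {ε : ℝ} (hε : 0 < ε) :
    ∃ d m : B, IsSelfAdjoint d ∧ d * s * d ≤ algebraMap ℝ B ε ∧ d * d ≤ 1 ∧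
      s * m * (1 - d) = 1 - d := by
  have hpos : ∀ t : ℝ, 0 < max t ε := fun t => hε.trans_le (le_max_right _ _)
  have hm : Continuous fun t : ℝ => (max t ε)⁻¹ :=
    (continuous_id.max continuous_const).inv₀ fun t => (hpos t).ne'
  have hd : Continuous fun t : ℝ => ε * (max t ε)⁻¹ := continuous_const.mul hm
  have hle : ∀ t : ℝ, ε * (max t ε)⁻¹ ≤ 1 := fun t => by
    rw [← div_eq_mul_inv]
    exact (div_le_one (hpos t)).2 (le_max_right _ _)
  have hnn : ∀ t : ℝ, 0 ≤ ε * (max t ε)⁻¹ := fun t =>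
    mul_nonneg hε.le (inv_nonneg.2 (hpos t).le)
  refine ⟨cfc (fun t : ℝ => ε * (max t ε)⁻¹) s, cfc (fun t : ℝ => (max t ε)⁻¹) s,
    cfc_predicate _ s, ?_, ?_, ?_⟩
  · have : cfc (fun t : ℝ => ε * (max t ε)⁻¹) s * s * cfc (fun t : ℝ => ε * (max t ε)⁻¹) s =
        cfc (fun t : ℝ => ε * (max t ε)⁻¹ * t * (ε * (max t ε)⁻¹)) s := by
      rw [cfc_mul (fun t : ℝ => ε * (max t ε)⁻¹ * t) _ s
        (hd.mul continuous_id).continuousOn hd.continuousOn,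
        cfc_mul (fun t : ℝ => ε * (max t ε)⁻¹) (fun t => t) s hd.continuousOn, cfc_id' ℝ s]
    rw [this]
    refine cfc_le_algebraMap _ ε s (fun t _ => ?_)
      ((hd.mul continuous_id).mul hd).continuousOn
    have h₁ : (max t ε)⁻¹ * t ≤ 1 := by
      rw [inv_mul_le_iff₀ (hpos t), mul_one]
      exact le_max_left _ _
    calc ε * (max t ε)⁻¹ * t * (ε * (max t ε)⁻¹)
        = ((max t ε)⁻¹ * t) * (ε * (ε * (max t ε)⁻¹)) := by ring
      _ ≤ 1 * (ε * (ε * (max t ε)⁻¹)) :=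
          mul_le_mul_of_nonneg_right h₁ (mul_nonneg hε.le (hnn t))
      _ ≤ 1 * (ε * 1) := by gcongr; exact hle t
      _ = ε := by ring
  · rw [← cfc_mul _ _ s hd.continuousOn hd.continuousOn]
    refine cfc_le_one _ s fun t _ => ?_
    exact mul_le_one₀ (hle t) (hnn t) (hle t)
  · have h1 : (1 : B) - cfc (fun t : ℝ => ε * (max t ε)⁻¹) s =
        cfc (fun t : ℝ => 1 - ε * (max t ε)⁻¹) s := by
      rw [cfc_sub (fun _ : ℝ => 1) (fun t : ℝ => ε * (max t ε)⁻¹) s continuousOn_const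
        hd.continuousOn, cfc_const_one ℝ s]
    rw [h1]
    have h2 : s * cfc (fun t : ℝ => (max t ε)⁻¹) s = cfc (fun t : ℝ => t * (max t ε)⁻¹) s := by
      rw [cfc_mul (fun t : ℝ => t) _ s continuousOn_id hm.continuousOn, cfc_id' ℝ s]
    rw [h2, ← cfc_mul (fun t : ℝ => t * (max t ε)⁻¹) (fun t : ℝ => 1 - ε * (max t ε)⁻¹) s
      (continuous_id.mul hm).continuousOn (continuous_const.sub hd).continuousOn]
    refine cfc_congr fun t _ => ?_
    rcases le_total t ε with h | h
    · simp [max_eq_right h, hε.ne']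
    · simp [max_eq_left h, (hε.trans_le h).ne']

theorem ClosedIdeal.exists_cutoff (J : ClosedIdeal B) {s : B} (hs : IsSelfAdjoint s)
    (hsJ : s ∈ J) {ε : ℝ} (hε : 0 < ε) :
    ∃ d : B, IsSelfAdjoint d ∧ 1 - d ∈ J ∧ d * s * d ≤ algebraMap ℝ B ε ∧ d * d ≤ 1 := by
  obtain ⟨d, m, hd, h₁, h₂, h₃⟩ := hs.exists_cutoff hε
  refine ⟨d, hd, ?_, h₁, h₂⟩
  rw [← h₃]
  exact J.mul_mem_right _ (J.mul_mem_right _ hsJ)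

/-- The C⋆-identity, for cutoffs of `x⋆x`. -/
theorem norm_mul_sq_le_of_le_algebraMap {x d : B} (hd : IsSelfAdjoint d) {ε : ℝ} (hε : 0 ≤ ε)
    (h : d * (star x * x) * d ≤ algebraMap ℝ B ε) : ‖x * d‖ ^ 2 ≤ ε := by
  have h' : star (x * d) * (x * d) = d * (star x * x) * d := by
    rw [star_mul, hd.star_eq]
    simp only [mul_assoc]
  rw [sq, ← CStarRing.norm_star_mul_self,
    CStarAlgebra.norm_le_iff_le_algebraMap _ hε (star_mul_self_nonneg _), h']
  exact h

/-- If `x⋆x` can be cut off to an arbitrarily small element by `d ∈ 1 + J`, then `x` is in `J`,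
because it is close to `x * (1 - d)`. -/
theorem ClosedIdeal.mem_of_forall_exists (J : ClosedIdeal B) {x : B}
    (h : ∀ ε : ℝ, 0 < ε → ∃ d, IsSelfAdjoint d ∧ 1 - d ∈ J ∧
      d * (star x * x) * d ≤ algebraMap ℝ B ε) : x ∈ J := by
  have hx : x ∈ closure (J : Set B) := by
    rw [Metric.mem_closure_iff]
    intro δ hδ
    obtain ⟨d, hd, hdJ, hxd⟩ := h ((δ / 2) ^ 2) (by positivity)
    refine ⟨x * (1 - d), J.mul_mem_left x hdJ, ?_⟩
    have hn := norm_mul_sq_le_of_le_algebraMap hd (by positivity) hxd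
    have hn' := (sq_le_sq₀ (norm_nonneg _) (by positivity)).1 hn
    rw [dist_eq_norm, mul_sub, mul_one, sub_sub_cancel]
    linarith
  rwa [J.isClosed.closure_eq] at hx

theorem ClosedIdeal.star_mem (J : ClosedIdeal B) {x : B} (hx : x ∈ J) : star x ∈ J := by
  refine J.mem_of_forall_exists fun ε hε => ?_
  obtain ⟨d, hd, hdJ, h, -⟩ := J.exists_cutoff (s := star (star x) * star x)
    (IsSelfAdjoint.star_mul_self _) (by rw [star_star]; exact J.mul_mem_right _ hx) hε
  exact ⟨d, hd, hdJ, h⟩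

/-- In the quotient by `J` the element `-x⋆x` is not positive, unless `x` is in `J`. -/
theorem ClosedIdeal.mem_of_neg_mem_closure (J : ClosedIdeal B) {x : B}
    (h : -(star x * x) ∈ closure {b : B | ∃ a j, 0 ≤ a ∧ j ∈ J ∧ b = a + j}) : x ∈ J := by
  refine J.mem_of_forall_exists fun ε hε => ?_
  obtain ⟨_, ⟨a, j, ha, hj, rfl⟩, hdist⟩ := Metric.mem_closure_iff.1 h (ε / 2) (by positivity)
  -- Up to sign, `s` is the real part of `j`, and `x⋆x ≤ ε / 2 + s`.
  set s : B := -((1 / 2 : ℝ) • (j + star j)) with hs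
  have hsJ : s ∈ J := J.toSubmodule.neg_mem
    (J.smul_mem_real _ (J.toSubmodule.add_mem hj (J.star_mem hj)))
  have hsa : IsSelfAdjoint s := by
    rw [hs, IsSelfAdjoint, star_neg, star_smul, star_add, star_star, add_comm (star j)]
    simp
  have ha' : star a = a := (IsSelfAdjoint.of_nonneg ha).star_eq
  have hle : star x * x ≤ algebraMap ℝ B (ε / 2) + s := by
    set y := -(star x * x) - (a + j) with hy
    have hy' : star x * x - s = (1 / 2 : ℝ) • ((-y) + star (-y)) - a := by
      rw [hs, hy]
      simp only [star_neg, star_sub, star_add, star_mul, star_star, ha']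
      module
    have hyn : ‖(1 / 2 : ℝ) • ((-y) + star (-y))‖ ≤ ε / 2 := by
      rw [dist_eq_norm, ← hy] at hdist
      rw [norm_smul]
      have := norm_add_le (-y) (star (-y))
      rw [norm_star, norm_neg] at this
      norm_num
      norm_num at this
      linarith
    have hysa : IsSelfAdjoint ((1 / 2 : ℝ) • ((-y) + star (-y))) := by
      rw [IsSelfAdjoint, star_smul, star_add, star_star, add_comm (star (-y))]
      simp
    rw [← sub_le_iff_le_add, hy']
    calc _ ≤ (1 / 2 : ℝ) • ((-y) + star (-y)) := sub_le_self _ ha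
      _ ≤ algebraMap ℝ B ‖(1 / 2 : ℝ) • ((-y) + star (-y))‖ :=
          IsSelfAdjoint.le_algebraMap_norm_self hysa
      _ ≤ algebraMap ℝ B (ε / 2) := by
          exact algebraMap_mono B hyn
  obtain ⟨d, hd, hdJ, hds, hdd⟩ := J.exists_cutoff hsa hsJ (half_pos hε)
  refine ⟨d, hd, hdJ, ?_⟩
  have h1 := star_left_conjugate_le_conjugate hle d
  rw [hd.star_eq, mul_add, add_mul] at h1
  have h2 : d * algebraMap ℝ B (ε / 2) * d ≤ algebraMap ℝ B (ε / 2) := by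
    rw [← Algebra.commutes, mul_assoc, Algebra.algebraMap_eq_smul_one, smul_mul_assoc, one_mul]
    exact smul_le_smul_of_nonneg_left hdd (half_pos hε).le
  calc _ ≤ _ := h1
    _ ≤ algebraMap ℝ B (ε / 2) + algebraMap ℝ B (ε / 2) := add_le_add h2 hds
    _ = algebraMap ℝ B ε := by rw [← map_add, add_halves]

/-- The complexification of the symmetrized functional `b ↦ (f b + f b⋆) / 2`. The explicit formula
serves to read off where the extension vanishes. -/
theorem exists_positiveLinearMap_of_real (f : B →ₗ[ℝ] ℝ) (hf : ∀ a, 0 ≤ a → 0 ≤ f a) :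
    ∃ φ : B →ₚ[ℂ] ℂ, (∀ a, IsSelfAdjoint a → φ a = f a) ∧
      ∀ b, φ b = ((f b + f (star b)) / 2 : ℝ) -
        Complex.I * ((f (Complex.I • b) + f (star (Complex.I • b))) / 2 : ℝ) := by
  let h : Module.Dual ℝ B :=
    { toFun := fun b => (f b + f (star b)) / 2
      map_add' := fun a b => by simp only [star_add, map_add]; ring
      map_smul' := fun r b => by
        simp only [star_smul, map_smul, star_trivial, smul_eq_mul, RingHom.id_apply]; ring }
  have happ : ∀ b, (h.extendRCLike b : ℂ) = ((f b + f (star b)) / 2 : ℝ) -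
        Complex.I * ((f (Complex.I • b) + f (star (Complex.I • b))) / 2 : ℝ) := fun b => rfl
  have hsa : ∀ a, IsSelfAdjoint a → (h.extendRCLike a : ℂ) = f a := fun a ha => by
    rw [happ, ha.star_eq, star_smul, ha.star_eq]
    simp
  exact ⟨PositiveLinearMap.mk₀ h.extendRCLike fun a ha => by
    rw [hsa a (.of_nonneg ha)]
    exact_mod_cast hf a ha, hsa, happ⟩

/-- Separate `-x⋆x` from the closed cone `closure (B₊ + J)` by the Hahn-Banach theorem. -/
theorem ClosedIdeal.exists_positiveLinearMap (J : ClosedIdeal B) {x : B} (hx : x ∉ J) :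
    ∃ φ : B →ₚ[ℂ] ℂ, (∀ j ∈ J, φ j = 0) ∧ φ (star x * x) ≠ 0 := by
  let K : PointedCone ℝ B :=
    { carrier := {b : B | ∃ a j, 0 ≤ a ∧ j ∈ J ∧ b = a + j}
      add_mem' := by
        rintro _ _ ⟨a, j, ha, hj, rfl⟩ ⟨a', j', ha', hj', rfl⟩
        exact ⟨a + a', j + j', add_nonneg ha ha', J.toSubmodule.add_mem hj hj', by abel⟩
      zero_mem' := ⟨0, 0, le_rfl, J.toSubmodule.zero_mem, by simp⟩
      smul_mem' := by
        rintro ⟨r, hr⟩ _ ⟨a, j, ha, hj, rfl⟩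
        exact ⟨r • a, r • j, smul_nonneg hr ha, J.smul_mem_real r hj, smul_add r a j⟩ }
  obtain ⟨f, hf, hfx⟩ := ProperCone.hyperplane_separation_point (x₀ := -(star x * x))
    (Submodule.closure K : ProperCone ℝ B) (fun h => hx (J.mem_of_neg_mem_closure h))
  have hfK : ∀ a j, 0 ≤ a → j ∈ J → 0 ≤ f (a + j) := fun a j ha hj =>
    hf _ (subset_closure ⟨a, j, ha, hj, rfl⟩)
  have hfJ : ∀ j ∈ J, f j = 0 := fun j hj => by
    have h₁ := hfK 0 j le_rfl hj
    have h₂ := hfK 0 (-j) le_rfl (J.toSubmodule.neg_mem hj)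
    rw [zero_add] at h₁ h₂
    rw [map_neg] at h₂
    linarith
  obtain ⟨φ, hφ, hφ'⟩ := exists_positiveLinearMap_of_real f.toLinearMap fun a ha => by
    simpa using hfK a 0 ha J.toSubmodule.zero_mem
  refine ⟨φ, fun j hj => ?_, ?_⟩
  · have hIj : Complex.I • j ∈ J := J.smul_mem' _ hj
    rw [hφ']
    simp only [ContinuousLinearMap.coe_coe]
    rw [hfJ _ hj, hfJ _ (J.star_mem hj), hfJ _ hIj, hfJ _ (J.star_mem hIj)]
    simp
  · rw [hφ _ (.star_mul_self x)]
    rw [map_neg] at hfx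
    simp only [ContinuousLinearMap.coe_coe]
    exact_mod_cast (neg_lt_zero.1 hfx).ne'

/-- The states of a unital C⋆-algebra that vanish on a closed ideal, as functions: in this way
they form a subset of a product of discs, with the topology of pointwise convergence. -/
def ClosedIdeal.states (J : ClosedIdeal B) : Set (B → ℂ) :=
  {f | ∃ φ : B →ₚ[ℂ] ℂ, φ 1 = 1 ∧ (∀ j ∈ J, φ j = 0) ∧ ⇑φ = f}

theorem ClosedIdeal.mem_states_iff (J : ClosedIdeal B) {f : B → ℂ} :
    f ∈ J.states ↔ (∀ a b, f (a + b) = f a + f b) ∧ (∀ (c : ℂ) a, f (c • a) = c * f a) ∧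
      (∀ a, 0 ≤ a → 0 ≤ f a) ∧ f 1 = 1 ∧ ∀ j ∈ J, f j = 0 := by
  constructor
  · rintro ⟨φ, h1, hJ, rfl⟩
    exact ⟨map_add φ, fun c a => by simp, fun a ha => φ.map_nonneg ha, h1, hJ⟩
  · rintro ⟨hadd, hsmul, hpos, h1, hJ⟩
    exact ⟨PositiveLinearMap.mk₀ { toFun := f, map_add' := hadd, map_smul' := hsmul } hpos,
      h1, hJ, rfl⟩

theorem PositiveLinearMap.norm_apply_le_of_map_one (φ : B →ₚ[ℂ] ℂ) (h : φ 1 = 1) (b : B) :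
    ‖φ b‖ ≤ ‖b‖ := by
  have hn : ∀ c : B, ‖φ.toPreGNS c‖ ≤ ‖c‖ := fun c => by
    have h₁ := φ.preGNS_norm_sq (φ.toPreGNS c)
    have h₂ := φ.norm_apply_le_of_nonneg (star c * c) (star_mul_self_nonneg c)
    rw [PositiveLinearMap.ofPreGNS_toPreGNS] at h₁
    rw [← h₁, h, norm_one, one_mul, CStarRing.norm_star_mul_self, norm_pow, Complex.norm_real,
      norm_norm, ← sq] at h₂
    exact (sq_le_sq₀ (norm_nonneg _) (norm_nonneg _)).1 h₂
  have hin : inner ℂ (φ.toPreGNS 1) (φ.toPreGNS b) = φ b := by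
    rw [PositiveLinearMap.preGNS_inner_def]
    simp
  rcases subsingleton_or_nontrivial B with hB | hB
  · simp [Subsingleton.elim b 0]
  calc ‖φ b‖ ≤ ‖φ.toPreGNS 1‖ * ‖φ.toPreGNS b‖ := hin ▸ norm_inner_le_norm _ _
    _ ≤ ‖(1 : B)‖ * ‖b‖ := mul_le_mul (hn 1) (hn b) (norm_nonneg _) (norm_nonneg _)
    _ = ‖b‖ := by rw [norm_one, one_mul]

theorem ClosedIdeal.isCompact_states (J : ClosedIdeal B) : IsCompact J.states := by
  refine (isCompact_univ_pi fun b : B => isCompact_closedBall (0 : ℂ) ‖b‖).of_isClosed_subset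
    ?_ ?_
  · have : J.states = {f : B → ℂ | (∀ a b, f (a + b) = f a + f b) ∧
        (∀ (c : ℂ) a, f (c • a) = c * f a) ∧ (∀ a, 0 ≤ a → 0 ≤ f a) ∧ f 1 = 1 ∧
        ∀ j ∈ J, f j = 0} := Set.ext fun f => J.mem_states_iff
    rw [this]
    simp only [Set.ofPred_and, Set.ofPred_forall]
    refine IsClosed.inter ?_ (IsClosed.inter ?_ (IsClosed.inter ?_ (IsClosed.inter ?_ ?_)))
    · exact isClosed_iInter fun a => isClosed_iInter fun b =>
        isClosed_eq (by fun_prop) (by fun_prop)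
    · exact isClosed_iInter fun a => isClosed_iInter fun b =>
        isClosed_eq (by fun_prop) (by fun_prop)
    · exact isClosed_iInter fun a => isClosed_iInter fun _ =>
        isClosed_le continuous_const (by fun_prop)
    · exact isClosed_eq (by fun_prop) continuous_const
    · exact isClosed_iInter fun a => isClosed_iInter fun _ =>
        isClosed_eq (by fun_prop) continuous_const
  · rintro _ ⟨φ, h1, -, rfl⟩ b -
    simpa using φ.norm_apply_le_of_map_one h1 b

theorem ClosedIdeal.convex_states (J : ClosedIdeal B) : Convex ℝ J.states := by
  intro f hf g hg s t hs ht hst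
  rw [mem_states_iff] at *
  obtain ⟨h₁, h₂, h₃, h₄, h₅⟩ := hf
  obtain ⟨k₁, k₂, k₃, k₄, k₅⟩ := hg
  refine ⟨fun a b => ?_, fun c a => ?_, fun a ha => ?_, ?_, fun j hj => ?_⟩
  · simp only [Pi.add_apply, Pi.smul_apply, h₁, k₁, smul_add]
    abel
  · simp only [Pi.add_apply, Pi.smul_apply, h₂, k₂, Complex.real_smul]
    ring
  · exact add_nonneg (smul_nonneg hs (h₃ a ha)) (smul_nonneg ht (k₃ a ha))
  · simp only [Pi.add_apply, Pi.smul_apply, h₄, k₄, Complex.real_smul, mul_one]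
    exact_mod_cast hst
  · simp [h₅ j hj, k₅ j hj]

/-- The pure states that vanish on a closed ideal separate the points of its complement from
`0`, by the Krein-Milman theorem. -/
theorem ClosedIdeal.exists_mem_extremePoints (J : ClosedIdeal B) {x : B} (hx : x ∉ J) :
    ∃ φ : B →ₚ[ℂ] ℂ, φ 1 = 1 ∧ (∀ j ∈ J, φ j = 0) ∧ ⇑φ ∈ J.states.extremePoints ℝ ∧
      φ (star x * x) ≠ 0 := by
  obtain ⟨ψ, hψJ, hψx⟩ := J.exists_positiveLinearMap hx
  have hψ1 : ψ 1 ≠ 0 := fun h => hψx (by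
    have := ψ.norm_apply_le_of_nonneg (star x * x) (star_mul_self_nonneg x)
    rw [h, norm_zero, zero_mul] at this
    exact norm_le_zero_iff.1 this)
  have hψ : (fun b => (ψ 1)⁻¹ * ψ b) ∈ J.states := by
    refine J.mem_states_iff.2 ⟨fun a b => by rw [map_add, mul_add], fun c a => ?_,
      fun a ha => ?_, inv_mul_cancel₀ hψ1, fun j hj => by rw [hψJ j hj, mul_zero]⟩
    · rw [map_smul, smul_eq_mul]
      ring
    · exact mul_nonneg (inv_nonneg.2 (ψ.map_nonneg zero_le_one)) (ψ.map_nonneg ha)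
  by_contra! H
  have hcl : J.states ⊆ {f | f (star x * x) = 0} := by
    rw [← closure_convexHull_extremePoints J.isCompact_states J.convex_states]
    refine closure_minimal (convexHull_min ?_ ?_) ?_
    · intro f hf
      obtain ⟨φ, h1, hJ, rfl⟩ := hf.1
      exact H φ h1 hJ hf
    · intro f hf g hg s t _ _ _
      have hf' : f (star x * x) = 0 := hf
      have hg' : g (star x * x) = 0 := hg
      change s • f (star x * x) + t • g (star x * x) = 0
      rw [hf', hg', smul_zero, smul_zero, add_zero]
    · exact isClosed_eq (by fun_prop) continuous_const
  exact mul_ne_zero (inv_ne_zero hψ1) hψx (hcl hψ)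

/-! ### The GNS representation of a pure state -/

theorem PositiveLinearMap.gns_apply_one (φ : B →ₚ[ℂ] ℂ) (b : B) :
    φ.gnsNonUnitalStarAlgHom b (φ.toPreGNS 1 : φ.GNS) = (φ.toPreGNS b : φ.GNS) := by
  rw [PositiveLinearMap.gnsNonUnitalStarAlgHom_apply_coe]
  simp

theorem PositiveLinearMap.inner_gns_one (φ : B →ₚ[ℂ] ℂ) (b c : B) :
    inner ℂ (φ.toPreGNS b : φ.GNS) (φ.toPreGNS c : φ.GNS) = φ (star b * c) := by
  rw [UniformSpace.Completion.inner_coe, PositiveLinearMap.preGNS_inner_def]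
  simp

theorem PositiveLinearMap.denseRange_gns (φ : B →ₚ[ℂ] ℂ) :
    DenseRange fun b : B => (φ.toPreGNS b : φ.GNS) :=
  UniformSpace.Completion.denseRange_coe.comp φ.toPreGNS.surjective.denseRange
    (UniformSpace.Completion.continuous_coe _)

theorem PositiveLinearMap.gns_eq_zero (φ : B →ₚ[ℂ] ℂ) {J : ClosedIdeal B}
    (hφ : ∀ j ∈ J, φ j = 0) {j : B} (hj : j ∈ J) : φ.gnsNonUnitalStarAlgHom j = 0 := by
  refine ContinuousLinearMap.ext fun η => congrFun (φ.denseRange_gns.equalizer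
    (ContinuousLinearMap.continuous _) (ContinuousLinearMap.continuous _) (funext fun b => ?_)) η
  have h : (φ.gnsNonUnitalStarAlgHom j) (φ.toPreGNS b : φ.GNS) =
      (φ.toPreGNS (j * b) : φ.GNS) := by
    rw [PositiveLinearMap.gnsNonUnitalStarAlgHom_apply_coe]
    simp
  change (φ.gnsNonUnitalStarAlgHom j) (φ.toPreGNS b : φ.GNS) = 0
  rw [h, ← inner_self_eq_zero (𝕜 := ℂ), PositiveLinearMap.inner_gns_one]
  exact hφ _ (J.mul_mem_left _ (J.mul_mem_right b hj))

/-- The GNS representation of an extreme point of the states vanishing on `J` is irreducible: an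
invariant subspace splits the state into two vector functionals, which have to be proportional. -/
theorem ClosedIdeal.gns_irreducible (J : ClosedIdeal B) (φ : B →ₚ[ℂ] ℂ) (h1 : φ 1 = 1)
    (hJ : ∀ j ∈ J, φ j = 0) (hφ : ⇑φ ∈ J.states.extremePoints ℝ) (K : Submodule ℂ φ.GNS)
    (hKc : IsClosed (K : Set φ.GNS))
    (hK : ∀ b, ∀ η ∈ K, φ.gnsNonUnitalStarAlgHom b η ∈ K) : K = ⊥ ∨ K = ⊤ := by
  have : CompleteSpace K := hKc.completeSpace_coe
  set π := φ.gnsNonUnitalStarAlgHom with hπ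
  set ξ : φ.GNS := (φ.toPreGNS 1 : φ.GNS) with hξ
  have hstar : ∀ b η ζ, inner ℂ (π b η) ζ = inner ℂ η (π (star b) ζ) := fun b η ζ => by
    rw [map_star, ContinuousLinearMap.star_eq_adjoint, ContinuousLinearMap.adjoint_inner_right]
  -- The projection onto `K` commutes with the representation.
  have hcomm : ∀ b η, K.starProjection (π b η) = π b (K.starProjection η) := fun b η => by
    refine Submodule.eq_starProjection_of_mem_of_inner_eq_zero
      (hK b _ (Submodule.starProjection_apply_mem K η)) fun w hw => ?_
    rw [← map_sub, hstar]
    exact Submodule.starProjection_inner_eq_zero _ _ (hK _ w hw)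
  set ξ₁ := K.starProjection ξ with hξ₁
  set ξ₂ := ξ - ξ₁ with hξ₂
  have hπξ : ∀ b, π b ξ = (φ.toPreGNS b : φ.GNS) := φ.gns_apply_one
  have hφξ : ∀ b, inner ℂ ξ (π b ξ) = φ b := fun b => by
    rw [hπξ, hξ, PositiveLinearMap.inner_gns_one, star_one, one_mul]
  have hPξ₁ : K.starProjection ξ₁ = ξ₁ :=
    Submodule.starProjection_eq_self_iff.2 (Submodule.starProjection_apply_mem K ξ)
  have hext : ∀ η : φ.GNS, (∀ b, inner ℂ η (π b ξ) = 0) → η = 0 := fun η h => by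
    refine φ.denseRange_gns.eq_zero_of_inner_left ℂ fun b => ?_
    rw [← hπξ]
    exact h b
  have hbot : ξ₁ = 0 → K = ⊥ := fun h => by
    refine (Submodule.eq_bot_iff K).2 fun k hk => hext k fun b => ?_
    rw [← Submodule.starProjection_eq_self_iff.2 hk, Submodule.inner_starProjection_left_eq_right,
      hcomm, ← hξ₁, h, map_zero, inner_zero_right]
  have htop : ξ₂ = 0 → K = ⊤ := fun h => by
    refine (Submodule.eq_top_iff').2 fun k => ?_
    have h0 : k - K.starProjection k = 0 := hext _ fun b => by
      have hb : K.starProjection (π b ξ) = π b ξ := by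
        rw [hcomm, ← hξ₁, ← sub_eq_zero.1 (hξ₂.symm.trans h)]
      exact Submodule.starProjection_inner_eq_zero _ _
        (Submodule.starProjection_eq_self_iff.1 hb)
    exact Submodule.starProjection_eq_self_iff.1 (sub_eq_zero.1 h0).symm
  have h₁₁ : ∀ b, inner ℂ ξ₁ (π b ξ₁) = inner ℂ ξ₁ (π b ξ) := fun b => by
    rw [hξ₁, ← hcomm, ← Submodule.inner_starProjection_left_eq_right, ← hξ₁, hPξ₁]
  have h₂₂ : ∀ b, inner ℂ ξ₂ (π b ξ₂) = φ b - inner ℂ ξ₁ (π b ξ₁) := fun b => by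
    have : inner ℂ ξ (π b ξ₁) = inner ℂ ξ₁ (π b ξ₁) := by
      have hb : K.starProjection (π b ξ₁) = π b ξ₁ := by rw [hcomm, hPξ₁]
      exact (congrArg (inner ℂ ξ) hb.symm).trans
        (Submodule.inner_starProjection_left_eq_right K ξ (π b ξ₁)).symm
    rw [hξ₂, map_sub, inner_sub_left, inner_sub_right, inner_sub_right, hφξ, this, h₁₁]
    ring
  have hone : ∀ η, π 1 η = η := fun η => by
    exact DFunLike.congr_fun φ.gnsStarAlgHom.map_one η
  have hpos : ∀ η : φ.GNS, ∀ a : B, 0 ≤ a → 0 ≤ inner ℂ η (π a η) := fun η a ha => by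
    obtain ⟨c, rfl⟩ := CStarAlgebra.nonneg_iff_eq_star_mul_self.1 ha
    rw [map_mul, mul_apply_eq_comp, ← hstar, inner_self_eq_norm_sq_to_K]
    positivity
  set t : ℝ := ‖ξ₁‖ ^ 2 with ht
  have ht₁ : inner ℂ ξ₁ (π 1 ξ₁) = (t : ℂ) := by
    rw [hone, inner_self_eq_norm_sq_to_K, ht]
    push_cast
    rfl
  have ht₂ : ((‖ξ₂‖ ^ 2 : ℝ) : ℂ) = 1 - t := by
    have := h₂₂ 1
    rw [h1, ht₁, hone, inner_self_eq_norm_sq_to_K] at this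
    rw [← this]
    push_cast
    rfl
  have ht₂' : ‖ξ₂‖ ^ 2 = 1 - t := by exact_mod_cast ht₂
  by_cases hξ₁0 : ξ₁ = 0
  · exact .inl (hbot hξ₁0)
  by_cases hξ₂0 : ξ₂ = 0
  · exact .inr (htop hξ₂0)
  exfalso
  have ht0 : 0 < t := by positivity
  have ht1 : 0 < 1 - t := by
    rw [← ht₂']
    positivity
  have hstate : ∀ (η : φ.GNS) (s : ℝ), 0 < s → inner ℂ η (π 1 η) = (s : ℂ) →
      (fun b => (s : ℂ)⁻¹ * inner ℂ η (π b η)) ∈ J.states := fun η s hs hη => by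
    refine J.mem_states_iff.2 ⟨fun a b => ?_, fun c a => ?_, fun a ha => ?_, ?_, fun j hj => ?_⟩
    · rw [map_add, add_apply, inner_add_right, mul_add]
    · rw [map_smul, smul_apply, inner_smul_right]
      ring
    · refine mul_nonneg (inv_nonneg.2 ?_) (hpos η a ha)
      exact_mod_cast hs.le
    · rw [hη]
      exact inv_mul_cancel₀ (by exact_mod_cast hs.ne')
    · rw [hπ, φ.gns_eq_zero hJ hj]
      simp
  have hs₂ : inner ℂ ξ₂ (π 1 ξ₂) = ((1 - t : ℝ) : ℂ) := by
    rw [h₂₂, h1, ht₁]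
    push_cast
    rfl
  have heq := hφ.2 (hstate ξ₁ t ht0 ht₁) (hstate ξ₂ (1 - t) ht1 hs₂)
    ⟨t, 1 - t, ht0, ht1, by ring, funext fun b => by
      have e1 : (t : ℂ) ≠ 0 := by exact_mod_cast ht0.ne'
      have e2 : ((1 - t : ℝ) : ℂ) ≠ 0 := by exact_mod_cast ht1.ne'
      simp only [Pi.add_apply, Pi.smul_apply, Complex.real_smul]
      rw [mul_inv_cancel_left₀ e1, mul_inv_cancel_left₀ e2, h₂₂]
      ring⟩
  have hprop : ξ₁ - (t : ℂ) • ξ = 0 := hext _ fun b => by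
    have hb := congrFun heq b
    have e1 : (t : ℂ) ≠ 0 := by exact_mod_cast ht0.ne'
    rw [inner_sub_left, inner_smul_left, hφξ, ← h₁₁, ← hb, Complex.conj_ofReal,
      mul_inv_cancel_left₀ e1, sub_self]
  have hP : ξ₁ = (t : ℂ) • ξ₁ := by
    have := congrArg K.starProjection (sub_eq_zero.1 hprop)
    rwa [hPξ₁, map_smul, ← hξ₁] at this
  have : ((1 - t : ℝ) : ℂ) • ξ₁ = 0 := by
    push_cast
    rw [sub_smul, one_smul, ← hP, sub_self]
  rcases smul_eq_zero.1 this with h | h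
  · exact ht1.ne' (by exact_mod_cast h)
  · exact hξ₁0 h

end Unital

/-! ### Passing to the unitization -/

section NonUnital

open scoped ComplexOrder CStarAlgebra

variable {A : Type u} [NonUnitalCStarAlgebra A]

/-- A closed ideal of a C⋆-algebra is a closed ideal of its unitization. -/
def ClosedIdeal.unitize (I : ClosedIdeal A) : ClosedIdeal (Unitization ℂ A) where
  carrier := Unitization.inr '' (I : Set A)
  add_mem' := by
    rintro _ _ ⟨x, hx, rfl⟩ ⟨y, hy, rfl⟩
    exact ⟨x + y, I.add_mem' hx hy, Unitization.inr_add ℂ x y⟩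
  zero_mem' := ⟨0, I.zero_mem', Unitization.inr_zero ℂ⟩
  smul_mem' := by
    rintro c _ ⟨x, hx, rfl⟩
    exact ⟨c • x, I.smul_mem' c hx, Unitization.inr_smul ℂ c x⟩
  mul_mem_left' := by
    rintro b _ ⟨x, hx, rfl⟩
    refine ⟨b.fst • x + b.snd * x, I.add_mem' (I.smul_mem' _ hx) (I.mul_mem_left _ hx), ?_⟩
    ext <;> simp
  mul_mem_right' := by
    rintro b _ ⟨x, hx, rfl⟩
    refine ⟨b.fst • x + x * b.snd, I.add_mem' (I.smul_mem' _ hx) (I.mul_mem_right _ hx), ?_⟩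
    ext <;> simp
  isClosed' := (Unitization.isometry_inr (𝕜 := ℂ) (A := A)).isClosedEmbedding.isClosedMap _
    I.isClosed

theorem ClosedIdeal.mem_unitize {I : ClosedIdeal A} {b : Unitization ℂ A} :
    b ∈ I.unitize ↔ ∃ x ∈ I, (x : Unitization ℂ A) = b := Iff.rfl

theorem ClosedIdeal.inr_mem_unitize {I : ClosedIdeal A} {x : A} :
    (x : Unitization ℂ A) ∈ I.unitize ↔ x ∈ I := by
  refine ⟨fun ⟨y, hy, hyx⟩ => ?_, fun hx => ⟨x, hx, rfl⟩⟩
  rwa [← Unitization.inr_injective hyx]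

/-- The kernel of a representation. -/
def ClosedIdeal.ker {H : Type v} [NormedAddCommGroup H] [InnerProductSpace ℂ H]
    [CompleteSpace H] (π : A →⋆ₙₐ[ℂ] (H →L[ℂ] H)) : ClosedIdeal A where
  carrier := {a | π a = 0}
  add_mem' {a b} ha hb := by
    change π (a + b) = 0
    rw [map_add, show π a = 0 from ha, show π b = 0 from hb, add_zero]
  zero_mem' := map_zero π
  smul_mem' c a ha := by
    change π (c • a) = 0
    rw [map_smul, show π a = 0 from ha, smul_zero]
  mul_mem_left' b a ha := by
    change π (b * a) = 0
    rw [map_mul, show π a = 0 from ha, mul_zero]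
  mul_mem_right' b a ha := by
    change π (a * b) = 0
    rw [map_mul, show π a = 0 from ha, zero_mul]
  isClosed' := isClosed_eq (map_continuous π) continuous_const

/-- Every closed ideal is an intersection of primitive ideals. -/
theorem ClosedIdeal.exists_isPrimitive (I : ClosedIdeal A) {x : A} (hx : x ∉ I) :
    ∃ P : ClosedIdeal A, P.IsPrimitive ∧ I ≤ P ∧ x ∉ P := by
  let _ : PartialOrder (Unitization ℂ A) := CStarAlgebra.spectralOrder _
  have : StarOrderedRing (Unitization ℂ A) := CStarAlgebra.spectralOrderedRing _
  obtain ⟨φ, h1, hJ, hφ, hφx⟩ := I.unitize.exists_mem_extremePoints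
    (x := (x : Unitization ℂ A)) (mt ClosedIdeal.inr_mem_unitize.1 hx)
  let π : A →⋆ₙₐ[ℂ] (φ.GNS →L[ℂ] φ.GNS) :=
    φ.gnsNonUnitalStarAlgHom.comp (Unitization.inrNonUnitalStarAlgHom ℂ A)
  have hπ : ∀ a, π a = φ.gnsNonUnitalStarAlgHom (a : Unitization ℂ A) := fun a => rfl
  have hπx : π x ≠ 0 := fun h => hφx (by
    have h₁ := φ.gns_apply_one (x : Unitization ℂ A)
    rw [← hπ, h] at h₁
    rw [← φ.inner_gns_one, ← h₁]
    simp)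
  refine ⟨.ker π, ⟨φ.GNS, inferInstance, inferInstance, inferInstance, π, ⟨⟨x, hπx⟩,
    fun K hKc hK => ?_⟩, fun a => Iff.rfl⟩, fun a ha => ?_, hπx⟩
  · refine I.unitize.gns_irreducible φ h1 hJ hφ K hKc fun b η hη => ?_
    have hone : φ.gnsNonUnitalStarAlgHom 1 = 1 := φ.gnsStarAlgHom.map_one
    have hb : b = b.fst • (1 : Unitization ℂ A) + (b.snd : Unitization ℂ A) := by
      ext <;> simp
    rw [hb, map_add, map_smul, hone]
    exact K.add_mem (K.smul_mem _ hη) (hK _ η hη)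
  · exact φ.gns_eq_zero hJ (ClosedIdeal.inr_mem_unitize.2 ha)

/-! ### The ideal lattice -/

/-- A compact element of the ideal lattice yields a compact open subset of the primitive ideal
space. -/
theorem ClosedIdeal.isCompact_of_compactlyContained_self {I : ClosedIdeal A}
    (hI : CompactlyContained I I) : IsCompact {P : PrimitiveIdealSpace A | ¬ I ≤ P.1} := by
  classical
  refine isCompact_of_finite_subcover fun {ι} U hU hcover => ?_
  choose J hJ using hU
  obtain ⟨_, ⟨t, rfl⟩, ht⟩ := hI (Set.range fun t : Finset ι => t.sup J) ⟨_, ∅, rfl⟩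
    (by
      rintro _ ⟨s, rfl⟩ _ ⟨t, rfl⟩
      exact ⟨_, ⟨s ∪ t, rfl⟩, Finset.sup_mono Finset.subset_union_left,
        Finset.sup_mono Finset.subset_union_right⟩)
    (by
      intro x hx
      by_contra hxD
      obtain ⟨P, hP, hDP, hxP⟩ := ClosedIdeal.exists_isPrimitive _ hxD
      obtain ⟨i, hi⟩ := Set.mem_iUnion.1
        (hcover (show (⟨P, hP⟩ : PrimitiveIdealSpace A) ∈ _ from fun h => hxP (h hx)))
      rw [hJ i] at hi
      refine hi (le_trans ?_ hDP)
      exact le_sSup ⟨{i}, Finset.sup_singleton⟩)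
  refine ⟨t, fun P hP => ?_⟩
  have : ∃ i ∈ t, ¬ J i ≤ P.1 := by
    by_contra! h
    exact hP (ht.trans (Finset.sup_le h))
  obtain ⟨i, hi, hiP⟩ := this
  refine Set.mem_biUnion hi ?_
  rw [hJ i]
  exact hiP

theorem ClosedIdeal.eq_bot_of_compactlyContained_self
    (hA : ∀ U : Set (PrimitiveIdealSpace A), IsOpen U → IsCompact U → U = ∅)
    {I : ClosedIdeal A} (hI : CompactlyContained I I) : I = ⊥ := by
  rw [← le_bot_iff]
  intro x hx
  by_contra hx0
  obtain ⟨P, hP, -, hxP⟩ := ClosedIdeal.exists_isPrimitive _ hx0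
  have h := hA _ ⟨I, rfl⟩ (ClosedIdeal.isCompact_of_compactlyContained_self hI)
  exact (Set.eq_empty_iff_forall_notMem.1 h ⟨P, hP⟩) fun h => hxP (h hx)

/-- A directed supremum of closed ideals is the closure of their union. -/
theorem ClosedIdeal.mem_closure_of_mem_sSup {D : Set (ClosedIdeal A)} (hne : D.Nonempty)
    (hD : DirectedOn (· ≤ ·) D) {x : A} (hx : x ∈ sSup D) :
    x ∈ closure {y : A | ∃ K ∈ D, y ∈ K} := by
  let S : ClosedIdeal A :=
    { carrier := closure {y : A | ∃ K ∈ D, y ∈ K}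
      add_mem' := fun ha hb => map_mem_closure₂ continuous_add ha hb (by
        rintro a ⟨K, hK, ha⟩ b ⟨K', hK', hb⟩
        obtain ⟨M, hM, hKM, hKM'⟩ := hD K hK K' hK'
        exact ⟨M, hM, M.add_mem' (hKM ha) (hKM' hb)⟩)
      zero_mem' := by
        obtain ⟨K, hK⟩ := hne
        exact subset_closure ⟨K, hK, K.zero_mem'⟩
      smul_mem' := fun c a ha => map_mem_closure (continuous_const_smul c) ha (by
        rintro a ⟨K, hK, ha⟩
        exact ⟨K, hK, K.smul_mem' c ha⟩)
      mul_mem_left' := fun b a ha => map_mem_closure (continuous_const_mul b) ha (by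
        rintro a ⟨K, hK, ha⟩
        exact ⟨K, hK, K.mul_mem_left b ha⟩)
      mul_mem_right' := fun b a ha => map_mem_closure (f := (· * b)) (continuous_mul_const b) ha (by
        rintro a ⟨K, hK, ha⟩
        exact ⟨K, hK, K.mul_mem_right b ha⟩)
      isClosed' := isClosed_closure }
  have hS : sSup D ≤ S := sSup_le fun K hK y hy => subset_closure ⟨K, hK, hy⟩
  exact hS hx

/-- If `e` acts as a left unit on `h`, the ideal generated by `h` is compactly contained in every
ideal containing `e`: if `y` is close to `e`, then `1 - (e - y)` is invertible in the unitization
and maps `h` to `y * h`. -/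
theorem ClosedIdeal.compactlyContained_of_mul_eq {J : ClosedIdeal A} {e h : A} (he : e ∈ J)
    (heh : e * h = h) : CompactlyContained (sInf {K : ClosedIdeal A | h ∈ K}) J := by
  intro D hne hD hJ
  obtain ⟨y, ⟨K, hK, hy⟩, hey⟩ := Metric.mem_closure_iff.1
    (ClosedIdeal.mem_closure_of_mem_sSup hne hD (hJ he)) 1 one_pos
  refine ⟨K, hK, sInf_le ?_⟩
  have hn : ‖((e - y : A) : Unitization ℂ A)‖ < 1 := by
    rwa [Unitization.norm_inr, ← dist_eq_norm]
  have hu : (Units.oneSub _ hn : Unitization ℂ A) * (h : Unitization ℂ A) =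
      ((y * h : A) : Unitization ℂ A) := by
    rw [Units.val_oneSub, sub_mul, one_mul, ← Unitization.inr_mul, sub_mul, heh,
      ← Unitization.inr_sub, sub_sub_cancel]
  have hmem := K.unitize.mul_mem_left (↑(Units.oneSub _ hn)⁻¹ : Unitization ℂ A)
    (ClosedIdeal.inr_mem_unitize.2 (K.mul_mem_right h hy))
  rw [← hu, Units.inv_mul_cancel_left] at hmem
  exact ClosedIdeal.inr_mem_unitize.1 hmem

/-- Every `x` in `J` is approximated by elements of ideals compactly contained in `J`. -/
theorem ClosedIdeal.isContinuousLattice : IsContinuousLattice (ClosedIdeal A) := by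
  let _ : PartialOrder (Unitization ℂ A) := CStarAlgebra.spectralOrder _
  have : StarOrderedRing (Unitization ℂ A) := CStarAlgebra.spectralOrderedRing _
  intro J Y hY x hx
  have hcl : x ∈ closure (Y : Set A) := by
    rw [Metric.mem_closure_iff]
    intro δ hδ
    -- With `e = x⋆x m` in `J` and `h = 1 - d` one has `e h = h`, and `x - x h = x d` is small.
    obtain ⟨d, m, hd, hds, -, hm⟩ :=
      (IsSelfAdjoint.star_mul_self (x : Unitization ℂ A)).exists_cutoff
        (show 0 < (δ / 2) ^ 2 by positivity)
    have hs : star (x : Unitization ℂ A) * (x : Unitization ℂ A) ∈ J.unitize :=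
      J.unitize.mul_mem_left _ (ClosedIdeal.inr_mem_unitize.2 hx)
    obtain ⟨e, he, hem⟩ := ClosedIdeal.mem_unitize.1 (J.unitize.mul_mem_right m hs)
    obtain ⟨h, -, hhd⟩ := ClosedIdeal.mem_unitize.1
      (hm ▸ J.unitize.mul_mem_right (1 - d) (J.unitize.mul_mem_right m hs))
    rw [← hem, ← hhd, ← Unitization.inr_mul] at hm
    have hle := hY _ (ClosedIdeal.compactlyContained_of_mul_eq he (Unitization.inr_injective hm))
    refine ⟨x * h, Y.mul_mem_left x (hle (ClosedIdeal.mem_sInf.2 fun K hK => hK)), ?_⟩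
    have hn := norm_mul_sq_le_of_le_algebraMap hd (by positivity) hds
    have hn' := (sq_le_sq₀ (norm_nonneg _) (by positivity)).1 hn
    have hxd : (x : Unitization ℂ A) * d = ((x - x * h : A) : Unitization ℂ A) := by
      rw [Unitization.inr_sub, Unitization.inr_mul, hhd, mul_sub, mul_one, sub_sub_cancel]
    rw [hxd, Unitization.norm_inr] at hn'
    rw [dist_eq_norm]
    linarith
  rwa [Y.isClosed.closure_eq] at hcl

end NonUnital

theorem lemma2p3 {A : Type u} [NonUnitalCStarAlgebra A] [TopologicalSpace.SeparableSpace A]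
    (hA : ∀ U : Set (PrimitiveIdealSpace A), IsOpen U → IsCompact U → U = ∅) :
    ∃ Φ : ClosedIdeal A → unitInterval, IsCuMorphism Φ ∧ Φ ⁻¹' {0} = {⊥} := by
  have : SecondCountableTopology A := UniformSpace.secondCountable_of_separable A
  obtain ⟨C, hC⟩ := exists_isContinuousChain ClosedIdeal.isContinuousLattice
    fun I hI => ClosedIdeal.eq_bot_of_compactlyContained_self hA hI
  have : Countable (TopologicalSpace.countableBasis A) :=
    (TopologicalSpace.countable_countableBasis A).to_subtype
  -- For every basic open set, the smallest ideal in the chain among those meeting the set.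
  refine hC.exists_isCuMorphism
    (fun U : TopologicalSpace.countableBasis A => sInf {I ∈ C | ((I : Set A) ∩ U).Nonempty})
    (fun U => hC.sInf_mem _ fun I hI => hI.1) fun I hI J hJ hIJ => ?_
  obtain ⟨x, hxJ, hxI⟩ := SetLike.exists_of_lt hIJ
  obtain ⟨U, hU, hxU, hUI⟩ := (TopologicalSpace.isBasis_countableBasis A).exists_subset_of_mem_open
    (show x ∈ (I : Set A)ᶜ from hxI) I.isClosed.isOpen_compl
  refine ⟨⟨U, hU⟩, le_sInf fun K hK => ?_, sInf_le ⟨hJ, x, hxJ, hxU⟩⟩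
  refine (hC.le_or_le I hI K hK.1).resolve_right fun hKI => ?_
  obtain ⟨y, hyK, hyU⟩ := hK.2
  exact hUI hyU (hKI hyK)
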